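/- **Setting.** Let $\Gamma$ be a finite $n$-player extensive-form game with perfect recall and utilities $u_i$ in $[0,1]$. Let $X_i$ be the polytope of sequence-form mixed strategies of player $i$, $X = X_1\times\dots\times X_n$, $Z$ the set of terminal nodes, and $\hat x[z]=\prod_i x_i[z]$ for $x \in X$, $z\in Z$. In each round $t=1,2,\dots$ a mediator, who has seen the strategy profiles $x^{(1)},\dots,x^{(t-1)}$ of all earlier rounds, picks payment functions $p_i^{(t)}: X\to[0,P]$, linear in $x_i$ and continuous in $x_{-i}$; then the players pick $x^{(t)}\in X$, and player $i$ gets $v_i^{(t)}(x_i^{(t)})$, where $v_i^{(t)}(x_i)=u_i(x_i,x_{-i}^{(t)})+p_i^{(t)}(x_i,x_{-i}^{(t)})$. The regret of player $i$ is $$\mathrm{Reg}_i^T=\frac1{P+1}\Big[\max_{x_i^*\in X_i}\sum_{t=1}^T v_i^{(t)}(x_i^*)-\sum_{t=1}^T v_i^{(t)}(x_i^{(t)})\Big].$$ For a function $R$, a play is *admissible* if $\mathrm{Reg}_i^T\le R(T)$ for every player $i$ and every $T$ (up to the horizon, if there is one). The mediator *respects the total budget* $B$ if $\sum_t\sum_i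 p_i^{(t)}(x^{(t)})\le B$ on every admissible play. Such a mediator *solves the steering problem* for a pure Nash equilibrium $d$ if on every admissible play, as $T\to\infty$, $\max_i\frac1T\sum_{t=1}^T p_i^{(t)}(x^{(t)})\to0$ and $\sum_{z\in Z}\big|\frac1T\sum_{t=1}^T\hat x^{(t)}[z]-\hat d[z]\big|\to0$. The mediator may either play one infinitely repeated game with a fixed $P$, or know the horizon: in that case there is one mediator, with its own $P_T$, for each horizon $T$; the budget holds up to the horizon; and the two limits are required for every choice of one admissible play $x^{(\cdot),T}$ per horizon $T$. **Proposition.** Consider the $2\times2$ coordination game in which both players get $\frac12$ at $(A,A)$, both get $1$ at $(B,B)$, and both get $0$ otherwise. Both $(A,A)$ and $(B,B)$ are Nash equilibria. There is a function $R(T)=O(\sqrt T)$ such that, for every $B\ge0$, no mediator that respects the total budget $B$ solves the steering problem for the target $(B,B)$ and the regret bound $R$, whether or not the mediator knows the horizon. Moreover, there is a number $N$ that depends only on $B$ and $R$ such that, against every mediator that respects the total budget $B$ (up to a finite or infinite horizon), there is an admissible play in which the players play $(A,A)$ in all but at most $N$ of the rounds. -/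

import Mathlib

open Filter Topology Asymptotics

noncomputable section

/-- Finite game trees for `n` players whose infosets are labelled by `I i` and whose legal actions
at the infoset `s` of player `i` are `A i s`. The nodes of player `i` that carry the same label `s`
form one information set. Utilities lie in `[0, 1]`. -/
inductive GameTree (n : ℕ) (I : Fin n → Type) (A : (i : Fin n) → I i → Type) : Type where
  | terminal (u : Fin n → Set.Icc (0 : ℝ) 1) : GameTree n I A
  | chance (m : ℕ) (c : stdSimplex ℝ (Fin m)) (next : Fin m → GameTree n I A) : GameTree n I A
  | decision (i : Fin n) (s : I i) (next : A i s → GameTree n I A) : GameTree n I A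

namespace GameTree

variable {n : ℕ} {I : Fin n → Type} {A : (i : Fin n) → I i → Type}

/-- The set `Z` of terminal nodes (a terminal node is the path that leads to it). -/
def Terminal : GameTree n I A → Type
  | terminal _ => Unit
  | chance m _ next => (j : Fin m) × (next j).Terminal
  | decision i s next => (a : A i s) × (next a).Terminal

/-- The terminal nodes of a finitely branching tree form a finite type. -/
@[reducible] def terminalFintype [∀ i s, Fintype (A i s)] : (t : GameTree n I A) → Fintype t.Terminal
  | terminal _ => inferInstanceAs (Fintype Unit)
  | chance m _ next =>
      haveI : ∀ j, Fintype (next j).Terminal := fun j => (next j).terminalFintype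
      inferInstanceAs (Fintype ((j : Fin m) × (next j).Terminal))
  | decision i s next =>
      haveI : ∀ a, Fintype (next a).Terminal := fun a => (next a).terminalFintype
      inferInstanceAs (Fintype ((a : A i s) × (next a).Terminal))

instance [∀ i s, Fintype (A i s)] (t : GameTree n I A) : Fintype t.Terminal := t.terminalFintype

/-- The utility `u_i(z)`. -/
def utility : (t : GameTree n I A) → t.Terminal → Fin n → ℝ
  | terminal u, _ => fun i => (u i : ℝ)
  | chance _ _ next, ⟨j, z⟩ => (next j).utility z
  | decision _ _ next, ⟨a, z⟩ => (next a).utility z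

/-- The probability with which chance plays all its actions on the path to `z`. -/
def chanceProb : (t : GameTree n I A) → t.Terminal → ℝ
  | terminal _, _ => 1
  | chance _ c next, ⟨j, z⟩ => (c : Fin _ → ℝ) j * (next j).chanceProb z
  | decision _ _ next, ⟨_, z⟩ => (next _).chanceProb z

/-- All infosets of the players on the path to `z`, with the actions played there, in order. -/
def path : (t : GameTree n I A) → t.Terminal → List ((i : Fin n) × (s : I i) × A i s)
  | terminal _, _ => []
  | chance _ _ next, ⟨j, z⟩ => (next j).path z
  | decision i s next, ⟨a, z⟩ => ⟨i, s, a⟩ :: (next a).path z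

/-- The sequence `σ_i(z)` of player `i`. -/
def sequence (t : GameTree n I A) (i : Fin n) (z : t.Terminal) :
    List ((i : Fin n) × (s : I i) × A i s) :=
  (t.path z).filter (fun e => decide (e.1 = i))

/-- Perfect recall: whenever the infoset `s` of player `i` is reached, the same infosets and
actions of player `i` precede it. -/
def PerfectRecall (t : GameTree n I A) : Prop :=
  ∀ (i : Fin n) (z z' : t.Terminal) (s : I i) (a a' : A i s)
    (l l' : List ((i : Fin n) × (s : I i) × A i s)),
    (l ++ [⟨i, s, a⟩]) <+: t.sequence i z → (l' ++ [⟨i, s, a'⟩]) <+: t.sequence i z' → l = l'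

end GameTree

/-- A finite extensive-form game with perfect recall and utilities in `[0, 1]`. -/
structure ExtensiveGame where
  n : ℕ
  Infoset : Fin n → Type
  Act : (i : Fin n) → Infoset i → Type
  [finiteInfoset : ∀ i, Finite (Infoset i)]
  [fintypeAct : ∀ i s, Fintype (Act i s)]
  [nonemptyAct : ∀ i s, Nonempty (Act i s)]
  tree : GameTree n Infoset Act
  perfectRecall : tree.PerfectRecall

attribute [instance] ExtensiveGame.finiteInfoset ExtensiveGame.fintypeAct
  ExtensiveGame.nonemptyAct

namespace ExtensiveGame

variable (Γ : ExtensiveGame)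

/-- The set `Z` of terminal nodes. -/
abbrev Z : Type := Γ.tree.Terminal

/-- The set `Σ_i` of sequences of player `i` that correspond to terminal nodes. -/
abbrev Seq (i : Fin Γ.n) : Type := Set.range (Γ.tree.sequence i)

/-- `σ_i(z)` as an element of `Σ_i`. -/
def seqOf (i : Fin Γ.n) (z : Γ.Z) : Γ.Seq i := ⟨Γ.tree.sequence i z, z, rfl⟩

/-- A pure strategy: one action at each infoset. -/
abbrev PureStrategy (i : Fin Γ.n) : Type := (s : Γ.Infoset i) → Γ.Act i s

open Classical in
/-- The sequence form of a pure strategy. -/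
def pureSeqForm (i : Fin Γ.n) (π : Γ.PureStrategy i) : Γ.Seq i → ℝ := fun σ =>
  if ∀ (s : Γ.Infoset i) (a : Γ.Act i s), ⟨i, s, a⟩ ∈ σ.1 → π s = a then 1 else 0

/-- The polytope `X_i` of sequence-form mixed strategies of player `i`. -/
def X (i : Fin Γ.n) : Set (Γ.Seq i → ℝ) := convexHull ℝ (Set.range (Γ.pureSeqForm i))

/-- Strategy profiles `X_1 × ⋯ × X_n`. -/
abbrev Profile : Type := (i : Fin Γ.n) → Γ.X i

/-- The profile of sequence forms of a profile of pure strategies. -/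
def pureProfile (d : (i : Fin Γ.n) → Γ.PureStrategy i) : Γ.Profile := fun i =>
  ⟨Γ.pureSeqForm i (d i), subset_convexHull ℝ _ ⟨d i, rfl⟩⟩

/-- `x̂[z] = ∏ i, x_i[σ_i(z)]`. -/
def reach (x : Γ.Profile) (z : Γ.Z) : ℝ := ∏ i, (x i : Γ.Seq i → ℝ) (Γ.seqOf i z)

/-- The expected utility `u_i(x)`. -/
def expUtility (i : Fin Γ.n) (x : Γ.Profile) : ℝ :=
  ∑ z : Γ.Z, Γ.tree.chanceProb z * Γ.reach x z * Γ.tree.utility z i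

/-- Nash equilibrium. -/
def IsNash (x : Γ.Profile) : Prop :=
  ∀ (i : Fin Γ.n) (y : Γ.X i), Γ.expUtility i (Function.update x i y) ≤ Γ.expUtility i x

/-- The allowed payment functions of player `i`: values in `[0, P]`, linear in `x_i`, continuous
in `x_{-i}`. -/
structure IsPaymentFunction (P : ℝ) (i : Fin Γ.n) (p : Γ.Profile → ℝ) : Prop where
  mem_Icc : ∀ x, p x ∈ Set.Icc 0 P
  linear : ∀ x : Γ.Profile, ∃ ℓ : (Γ.Seq i → ℝ) →ₗ[ℝ] ℝ,
    ∀ y : Γ.X i, p (Function.update x i y) = ℓ (y : Γ.Seq i → ℝ)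
  continuous : ∀ y : Γ.X i, Continuous fun x : Γ.Profile => p (Function.update x i y)

/-- A strategy of the mediator with per-round payments at most `P`: the payment functions of a
round may depend on the strategy profiles of all the earlier rounds. Rounds are numbered from
`0`, so that `t` profiles have been observed when round `t` begins. -/
structure Mediator (P : ℝ) where
  pay : (t : ℕ) → (Fin t → Γ.Profile) → Fin Γ.n → Γ.Profile → ℝ
  isPayment : ∀ t h i, Γ.IsPaymentFunction P i (pay t h i)

/-- The directness gap after `T` rounds of the play `x`, for the target profile `d`. -/
def directnessGap (d : Γ.Profile) (x : ℕ → Γ.Profile) (T : ℕ) : ℝ :=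
  ∑ z : Γ.Z, |(1 / (T : ℝ)) * ∑ t ∈ Finset.range T, Γ.reach (x t) z - Γ.reach d z|

namespace Mediator

variable {Γ} {P : ℝ} (σ : Γ.Mediator P)

/-- The payment function `p_i^{(t)}` when the players play `x`. -/
def payment (x : ℕ → Γ.Profile) (t : ℕ) (i : Fin Γ.n) : Γ.Profile → ℝ :=
  σ.pay t (fun s => x s) i

/-- `v_i^{(t)}(y) = u_i(y, x_{-i}^{(t)}) + p_i^{(t)}(y, x_{-i}^{(t)})`. -/
def roundUtility (x : ℕ → Γ.Profile) (t : ℕ) (i : Fin Γ.n) (y : Γ.X i) : ℝ :=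
  Γ.expUtility i (Function.update (x t) i y) + σ.payment x t i (Function.update (x t) i y)

/-- The normalized regret of player `i` after `T` rounds. -/
def regret (x : ℕ → Γ.Profile) (i : Fin Γ.n) (T : ℕ) : ℝ :=
  (1 / (P + 1)) * ((⨆ y : Γ.X i, ∑ t ∈ Finset.range T, σ.roundUtility x t i y) -
    ∑ t ∈ Finset.range T, σ.roundUtility x t i (x t i))

/-- The players have regret at most `R(T)` at every time `T` up to the horizon `τ`
(`τ = ⊤`: at all times). -/
def RegretBounded (R : ℕ → ℝ) (τ : ℕ∞) (x : ℕ → Γ.Profile) : Prop :=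
  ∀ T : ℕ, (T : ℕ∞) ≤ τ → ∀ i, σ.regret x i T ≤ R T

/-- The total realized payment never exceeds `B` up to the horizon `τ`, however the players play
subject to the regret bound. -/
def RespectsBudget (R : ℕ → ℝ) (B : ℝ) (τ : ℕ∞) : Prop :=
  ∀ x : ℕ → Γ.Profile, σ.RegretBounded R τ x →
    ∀ T : ℕ, (T : ℕ∞) ≤ τ → ∑ t ∈ Finset.range T, ∑ i, σ.payment x t i (x t) ≤ B

/-- The largest time-averaged realized payment to a player. -/
def avgPayment (x : ℕ → Γ.Profile) (T : ℕ) : ℝ :=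
  ⨆ i, (1 / (T : ℝ)) * ∑ t ∈ Finset.range T, σ.payment x t i (x t)

end Mediator

/-- The steering problem with target `d`, regret bound `R` and total budget `B` is solved by a
mediator that does not know the horizon, in the infinitely repeated game. -/
def AnytimeSteerable (d : Γ.Profile) (R : ℕ → ℝ) (B : ℝ) : Prop :=
  ∃ (P : ℝ) (σ : Γ.Mediator P), σ.RespectsBudget R B ⊤ ∧
    ∀ x : ℕ → Γ.Profile, σ.RegretBounded R ⊤ x →
      Tendsto (σ.avgPayment x) atTop (𝓝 0) ∧ Tendsto (Γ.directnessGap d x) atTop (𝓝 0)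

/-- The steering problem with target `d`, regret bound `R` and total budget `B` is solved by a
mediator that knows the horizon: for each `T` there is a mediator `σ T` for `T` rounds, and the
averages over `T` rounds converge as `T → ∞`, whatever the players do for each horizon. -/
def HorizonSteerable (d : Γ.Profile) (R : ℕ → ℝ) (B : ℝ) : Prop :=
  ∃ (P : ℕ → ℝ) (σ : (T : ℕ) → Γ.Mediator (P T)), (∀ T : ℕ, (σ T).RespectsBudget R B T) ∧
    ∀ x : ℕ → ℕ → Γ.Profile, (∀ T : ℕ, (σ T).RegretBounded R T (x T)) →
      Tendsto (fun T => (σ T).avgPayment (x T) T) atTop (𝓝 0) ∧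
        Tendsto (fun T => Γ.directnessGap d (x T) T) atTop (𝓝 0)

end ExtensiveGame

/-- The payoff, to each of the two players, of the coordination game; action `0` is `A` and
action `1` is `B`. -/
def coordPayoff (a b : Fin 2) : Set.Icc (0 : ℝ) 1 :=
  if a = b then (if a = 0 then ⟨1 / 2, by norm_num, by norm_num⟩ else 1) else 0

/-- The tree of the coordination game: the second player does not see the first player's action. -/
def coordTree : GameTree 2 (fun _ => Unit) (fun _ _ => Fin 2) :=
  .decision 0 () fun a => .decision 1 () fun b => .terminal fun _ => coordPayoff a b

theorem coordTree_length_sequence (i : Fin 2) (z : coordTree.Terminal) :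
    (coordTree.sequence i z).length ≤ 1 := by
  obtain ⟨a, b, u⟩ := z
  fin_cases i <;> simp [coordTree, GameTree.sequence, GameTree.path]

theorem coordTree_perfectRecall : coordTree.PerfectRecall := by
  intro i z z' s a a' l l' h h'
  have h1 := h.length_le.trans (coordTree_length_sequence i z)
  have h2 := h'.length_le.trans (coordTree_length_sequence i z')
  simp only [List.length_append, List.length_singleton] at h1 h2
  rw [List.length_eq_zero_iff.mp (by omega : l.length = 0),
    List.length_eq_zero_iff.mp (by omega : l'.length = 0)]

/-- The 2×2 coordination game. -/
def coordGame : ExtensiveGame where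
  n := 2
  Infoset := fun _ => Unit
  Act := fun _ _ => Fin 2
  tree := coordTree
  perfectRecall := coordTree_perfectRecall

/-- The pure profile `(A, A)`. -/
def coordAA : coordGame.Profile := coordGame.pureProfile fun _ _ => (0 : Fin 2)

/-- The pure profile `(B, B)`. -/
def coordBB : coordGame.Profile := coordGame.pureProfile fun _ _ => (1 : Fin 2)

end

/-! To make the players leave (A, A), the mediator must make some deviation from it profitable. That
deviation loses the utility 1/2, so the payment offered at the deviation profile exceeds 1/2
(`exists_half_le_payment`). The players can simply take this money: playing the off-equilibrium
profile costs at most P + 1 in cumulative gain, that is, at most 1 in normalized regret, whatever P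
is.

With R(T) = √T and K > 2B, the players spend the first K² rounds on Nash equilibria of the round
with payments, which cost no regret (`exists_isNashWith_coordGame`). By then the bound leaves room
for K bad rounds. From there on they play (A, A) when it is an equilibrium of the round, and
otherwise the profile paid at least 1/2. After K departures they would return to round equilibria,
so the play is admissible whatever the mediator does. The budget therefore applies to it, and K
departures would cost K/2 > B. So at most K² + K rounds differ from (A, A), uniformly in P and in
the horizon, and the average reach of (A, A) tends to 1 instead of 0. -/

/-! ### Coordinates: strategies as probabilities of B -/

/-- The one-element sequence of player `i` that plays the action `a` of the coordination game. -/
def coordSeq (i : Fin coordGame.n) (a : Fin 2) : coordGame.Seq i :=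
  ⟨[⟨i, (), a⟩], by
    refine ⟨(⟨a, a, ()⟩ : (_ : Fin 2) × (_ : Fin 2) × Unit), ?_⟩
    revert i
    change ∀ i : Fin 2, _
    intro i
    fin_cases i <;> rfl⟩

/-- The terminal node of the coordination game reached by the actions `a` and `b`. -/
def coordTerminal (a b : Fin 2) : coordGame.Z := (⟨a, b, ()⟩ : (_ : Fin 2) × (_ : Fin 2) × Unit)

theorem coordGame_sum_terminal (f : coordGame.Z → ℝ) :
    ∑ z, f z = ∑ a : Fin 2, ∑ b : Fin 2, f (coordTerminal a b) := by
  have h (g : (_ : Fin 2) × (_ : Fin 2) × Unit → ℝ) :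
      ∑ z, g z = ∑ a : Fin 2, ∑ b : Fin 2, g ⟨a, b, ()⟩ := by
    rw [Fintype.sum_sigma]
    refine Finset.sum_congr rfl fun a _ => ?_
    rw [Fintype.sum_sigma]
    simp
  exact h f

/-- The pure strategy of player `i` that plays `a`. -/
def coordPure (i : Fin coordGame.n) (a : Fin 2) : coordGame.PureStrategy i := fun _ => a

theorem coordGame_pureSeqForm (i : Fin coordGame.n) (a b : Fin 2) :
    coordGame.pureSeqForm i (coordPure i a) (coordSeq i b) = if a = b then 1 else 0 := by
  classical
  unfold ExtensiveGame.pureSeqForm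
  refine (if_congr ?_ rfl rfl)
  simp only [coordSeq, List.mem_singleton]
  constructor
  · intro h; exact h () b rfl
  · rintro h s a' h'
    cases h'
    exact h

theorem coordGame_expUtility (i : Fin coordGame.n) (x : coordGame.Profile) :
    coordGame.expUtility i x = 1 / 2 * coordGame.reach x (coordTerminal 0 0) +
      coordGame.reach x (coordTerminal 1 1) := by
  have h1 : ∀ a b, coordGame.tree.chanceProb (coordTerminal a b) = 1 := fun _ _ => rfl
  have h2 : ∀ a b, coordGame.tree.utility (coordTerminal a b) i = coordPayoff a b := fun _ _ => rfl
  rw [ExtensiveGame.expUtility, coordGame_sum_terminal]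
  simp [h1, h2, Fin.sum_univ_two, coordPayoff]
  ring

/-- The strategy of player `i` that plays `B` with probability `c`. -/
noncomputable def coordMix (i : Fin coordGame.n) (c : unitInterval) : coordGame.X i :=
  ⟨AffineMap.lineMap (coordGame.pureSeqForm i (coordPure i 0))
      (coordGame.pureSeqForm i (coordPure i 1)) (c : ℝ),
    (convex_convexHull ℝ _).lineMap_mem (subset_convexHull ℝ _ (Set.mem_range_self _))
      (subset_convexHull ℝ _ (Set.mem_range_self _)) c.2⟩

/-- There are only two pure strategies, so the strategy polytope is the segment that joins them. -/
theorem coordMix_surjective (i : Fin coordGame.n) : Function.Surjective (coordMix i) := by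
  rintro ⟨y, hy⟩
  have hr : Set.range (coordGame.pureSeqForm i) =
      {coordGame.pureSeqForm i (coordPure i 0),
        coordGame.pureSeqForm i (coordPure i 1)} := by
    ext z
    simp only [Set.mem_range, Set.mem_insert_iff, Set.mem_singleton_iff]
    constructor
    · rintro ⟨π, rfl⟩
      have hπ : ∀ a : Fin 2, π () = a → π = coordPure i a := fun a h => funext fun _ => h
      have h2 : ∀ a : Fin 2, a = 0 ∨ a = 1 := by decide
      rcases h2 (π ()) with h | h
      · exact Or.inl (congrArg _ (hπ _ h))
      · exact Or.inr (congrArg _ (hπ _ h))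
    · rintro (rfl | rfl) <;> exact ⟨_, rfl⟩
  rw [ExtensiveGame.X, hr, convexHull_pair, segment_eq_image_lineMap] at hy
  obtain ⟨c, hc, rfl⟩ := hy
  exact ⟨⟨c, hc⟩, rfl⟩

theorem coordMix_apply (i : Fin coordGame.n) (c : unitInterval) (a : Fin 2) :
    (coordMix i c : coordGame.Seq i → ℝ) (coordSeq i a) = if a = 0 then 1 - (c : ℝ) else c := by
  have h2 : a = 0 ∨ a = 1 := by revert a; decide
  have h : (coordMix i c : coordGame.Seq i → ℝ) =
      (1 - (c : ℝ)) • coordGame.pureSeqForm i (coordPure i 0) +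
        (c : ℝ) • coordGame.pureSeqForm i (coordPure i 1) := AffineMap.lineMap_apply_module _ _ _
  rw [h]
  simp only [Pi.add_apply, Pi.smul_apply, coordGame_pureSeqForm]
  rcases h2 with rfl | rfl <;> simp

theorem continuous_coordMix (i : Fin coordGame.n) : Continuous (coordMix i) :=
  Continuous.subtype_mk (AffineMap.lineMap_continuous.comp continuous_subtype_val) _

/-- The profile in which player `i` plays `B` with probability `w i`. -/
noncomputable def coordMixProfile (w : Fin coordGame.n → unitInterval) : coordGame.Profile := fun i => coordMix i (w i)

theorem continuous_coordMixProfile : Continuous coordMixProfile :=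
  continuous_pi fun i => (continuous_coordMix i).comp
    (continuous_apply (A := fun _ : Fin coordGame.n => unitInterval) i)

theorem coordMixProfile_surjective : Function.Surjective coordMixProfile := fun x => by
  choose w hw using fun i => coordMix_surjective i (x i)
  exact ⟨w, funext hw⟩

theorem update_coordMixProfile (w : Fin coordGame.n → unitInterval) (i : Fin coordGame.n) (c : unitInterval) :
    Function.update (coordMixProfile w) i (coordMix i c) =
      coordMixProfile (Function.update w i c) := by
  funext j
  rcases eq_or_ne j i with rfl | h
  · simp only [coordMixProfile, Function.update_self]
  · simp only [coordMixProfile, Function.update_of_ne h]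

theorem coordMixProfile_zero : coordMixProfile (fun _ => 0) = coordAA := by
  funext i
  exact Subtype.ext (AffineMap.lineMap_apply_zero _ _)

theorem coordMixProfile_one : coordMixProfile (fun _ => 1) = coordBB := by
  funext i
  exact Subtype.ext (AffineMap.lineMap_apply_one _ _)

/-! ### The bilinear payoff and the two equilibria -/

/-- The expected payoff in the coordination game when player `i` plays `B` with probability
`w i`. -/
noncomputable def coordUtility (w : Fin 2 → unitInterval) : ℝ :=
  1 / 2 * ((1 - (w 0 : ℝ)) * (1 - (w 1 : ℝ))) + w 0 * w 1

theorem coordUtility_nonneg (w : Fin 2 → unitInterval) : 0 ≤ coordUtility w := by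
  have h0 := sub_nonneg.mpr (w 0).2.2
  have h1 := sub_nonneg.mpr (w 1).2.2
  have := (w 0).2.1
  have := (w 1).2.1
  unfold coordUtility
  positivity

theorem coordUtility_le_one (w : Fin 2 → unitInterval) : coordUtility w ≤ 1 := by
  have := (w 0).2.2
  have := (w 1).2.2
  have := (w 0).2.1
  have := (w 1).2.1
  unfold coordUtility
  nlinarith

theorem coordUtility_update (w : Fin 2 → unitInterval) (i : Fin 2) (c : unitInterval) :
    coordUtility (Function.update w i c) = (1 - (c : ℝ)) * coordUtility (Function.update w i 0) +
      c * coordUtility (Function.update w i 1) := by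
  fin_cases i <;> simp [coordUtility] <;> ring

theorem continuous_coordUtility : Continuous coordUtility := by
  unfold coordUtility
  fun_prop

theorem coordUtility_update_zero_le (i : Fin 2) (c : unitInterval) :
    coordUtility (Function.update (fun _ => 0) i c) ≤ coordUtility fun _ => 0 := by
  have := c.2.1
  fin_cases i <;> simp [coordUtility] <;> linarith

theorem coordUtility_update_one_le (i : Fin 2) (c : unitInterval) :
    coordUtility (Function.update (fun _ => 1) i c) ≤ coordUtility fun _ => 1 := by
  have := c.2.2
  fin_cases i <;> simpa [coordUtility]

theorem reach_coordMixProfile (w : Fin coordGame.n → unitInterval) (a b : Fin 2) :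
    coordGame.reach (coordMixProfile w) (coordTerminal a b) =
      (if a = 0 then 1 - (w (0 : Fin 2) : ℝ) else w (0 : Fin 2)) *
        (if b = 0 then 1 - (w (1 : Fin 2) : ℝ) else w (1 : Fin 2)) :=
  (Fin.prod_univ_two (M := ℝ) _).trans
    (congrArg₂ _ (coordMix_apply (0 : Fin 2) _ a) (coordMix_apply (1 : Fin 2) _ b))

theorem expUtility_coordMixProfile (i : Fin coordGame.n) (w : Fin coordGame.n → unitInterval) :
    coordGame.expUtility i (coordMixProfile w) = coordUtility w := by
  rw [coordGame_expUtility, reach_coordMixProfile, reach_coordMixProfile]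
  simp [coordUtility]

theorem coordAA_isNash : coordGame.IsNash coordAA := by
  intro i y
  obtain ⟨c, rfl⟩ := coordMix_surjective i y
  rw [← coordMixProfile_zero, update_coordMixProfile, expUtility_coordMixProfile,
    expUtility_coordMixProfile]
  exact coordUtility_update_zero_le i c

theorem coordBB_isNash : coordGame.IsNash coordBB := by
  intro i y
  obtain ⟨c, rfl⟩ := coordMix_surjective i y
  rw [← coordMixProfile_one, update_coordMixProfile, expUtility_coordMixProfile,
    expUtility_coordMixProfile]
  exact coordUtility_update_one_le i c

/-! ### Equilibria of 2×2 games with continuous payoffs -/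

/-- Reduces the equilibrium condition to deviations to the two pure actions. -/
theorem le_of_affine {g : unitInterval → ℝ} {v : ℝ} (c : unitInterval)
    (hg : g c = (1 - (c : ℝ)) * g 0 + c * g 1) (h0 : g 0 ≤ v) (h1 : g 1 ≤ v) : g c ≤ v := by
  have := c.2.1
  have := c.2.2
  rw [hg]
  nlinarith

/-- A two-player game on the unit square whose payoffs are affine in the own strategy and
continuous in the strategy of the other player has a Nash equilibrium. -/
theorem exists_nash_unitSquare (V : Fin 2 → (Fin 2 → unitInterval) → ℝ)
    (haff : ∀ i w (c : unitInterval), V i (Function.update w i c) =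
      (1 - (c : ℝ)) * V i (Function.update w i 0) + c * V i (Function.update w i 1))
    (hcont : ∀ i c, Continuous fun w => V i (Function.update w i c)) :
    ∃ w, ∀ i c, V i (Function.update w i c) ≤ V i w := by
  have u0 : ∀ a b c : unitInterval, Function.update ![a, b] 0 c = ![c, b] := by
    intro a b c; funext j; fin_cases j <;> simp
  have u1 : ∀ a b c : unitInterval, Function.update ![a, b] 1 c = ![a, c] := by
    intro a b c; funext j; fin_cases j <;> simp
  have a0 : ∀ a b : unitInterval, V 0 ![a, b] =
      (1 - (a : ℝ)) * V 0 ![0, b] + a * V 0 ![1, b] := by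
    intro a b; simpa only [u0] using haff 0 ![a, b] a
  have a1 : ∀ a b : unitInterval, V 1 ![a, b] =
      (1 - (b : ℝ)) * V 1 ![a, 0] + b * V 1 ![a, 1] := by
    intro a b; simpa only [u1] using haff 1 ![a, b] b
  have c0 : ∀ c : unitInterval, Continuous fun b : unitInterval => V 0 ![c, b] := by
    intro c
    have hf : Continuous fun b : unitInterval => (![0, b] : Fin 2 → unitInterval) := by
      fun_prop
    simpa only [Function.comp_def, u0] using (hcont 0 c).comp hf
  have c1 : ∀ c : unitInterval, Continuous fun a : unitInterval => V 1 ![a, c] := by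
    intro c
    have hf : Continuous fun a : unitInterval => (![a, 0] : Fin 2 → unitInterval) := by
      fun_prop
    simpa only [Function.comp_def, u1] using (hcont 1 c).comp hf
  suffices h : ∃ a b : unitInterval, V 0 ![0, b] ≤ V 0 ![a, b] ∧ V 0 ![1, b] ≤ V 0 ![a, b] ∧
      V 1 ![a, 0] ≤ V 1 ![a, b] ∧ V 1 ![a, 1] ≤ V 1 ![a, b] by
    obtain ⟨a, b, h1, h2, h3, h4⟩ := h
    refine ⟨![a, b], fun i c => ?_⟩
    fin_cases i
    · simp only [Fin.zero_eta, u0]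
      exact le_of_affine (g := fun c => V 0 ![c, b]) c (a0 c b) h1 h2
    · simp only [Fin.mk_one, u1]
      exact le_of_affine (g := fun c => V 1 ![a, c]) c (a1 a c) h3 h4
  by_contra! hn
  -- Without an equilibrium at a corner, the best responses at the corners run in a cycle. Each
  -- player's gain from switching actions then changes sign along the other's interval, and the
  -- intermediate value theorem makes it vanish.
  have key : (∃ b, V 0 ![1, b] - V 0 ![0, b] = 0) ∧ ∃ a, V 1 ![a, 1] - V 1 ![a, 0] = 0 := by
    have d0 : Continuous fun b => V 0 ![1, b] - V 0 ![0, b] := (c0 1).sub (c0 0)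
    have d1 : Continuous fun a => V 1 ![a, 1] - V 1 ![a, 0] := (c1 1).sub (c1 0)
    have n00 := hn 0 0 le_rfl
    have n01 := hn 0 1 le_rfl
    have n10 := hn 1 0
    have n11 := hn 1 1
    rcases le_total (V 0 ![1, 0]) (V 0 ![0, 0]) with h | h <;>
    rcases le_total (V 0 ![1, 1]) (V 0 ![0, 1]) with h' | h' <;>
    rcases le_total (V 1 ![0, 1]) (V 1 ![0, 0]) with k | k <;>
    rcases le_total (V 1 ![1, 1]) (V 1 ![1, 0]) with k' | k' <;>
    first
    | (exfalso; grind)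
    | (constructor
       · first
         | exact mem_range_of_exists_le_of_exists_ge d0 ⟨0, by linarith⟩ ⟨1, by linarith⟩
         | exact mem_range_of_exists_le_of_exists_ge d0 ⟨1, by linarith⟩ ⟨0, by linarith⟩
       · first
         | exact mem_range_of_exists_le_of_exists_ge d1 ⟨0, by linarith⟩ ⟨1, by linarith⟩
         | exact mem_range_of_exists_le_of_exists_ge d1 ⟨1, by linarith⟩ ⟨0, by linarith⟩)
  obtain ⟨⟨b, hb⟩, a, ha⟩ := key
  -- At the two zeros both players are indifferent, so `![a, b]` is an equilibrium after all.
  have e0 : V 0 ![a, b] = V 0 ![0, b] := by rw [a0]; linear_combination (a : ℝ) * hb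
  have e1 : V 1 ![a, b] = V 1 ![a, 0] := by rw [a1]; linear_combination (b : ℝ) * ha
  have := hn a b (by linarith) (by linarith) (by linarith)
  linarith

/-! ### Plays defined by recursion, and counting rounds -/

/-- A sequence may be defined by a rule that takes the next value from all the earlier ones. -/
theorem exists_seq_of_history {α : Type*} {Q : (t : ℕ) → (Fin t → α) → α → Prop}
    (h : ∀ t g, ∃ y, Q t g y) : ∃ x : ℕ → α, ∀ t, Q t (fun s => x s) (x t) := by
  choose S hS using h
  let x : ℕ → α := fun t => Nat.strongRec (fun t g => S t fun s => g s.1 s.2) t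
  have hx : ∀ t, x t = S t fun s => x s := fun t => Nat.strongRec_eq _ _
  refine ⟨x, fun t => ?_⟩
  have := hS t fun s => x s
  rwa [← hx] at this

/-- If there were `N + 1` such rounds, all of them would lie in one finite prefix within the
horizon. This covers `τ = ⊤` as well. -/
theorem Set.encard_setOf_lt_le {τ : ℕ∞} {p : ℕ → Prop} [DecidablePred p] {N : ℕ}
    (h : ∀ T : ℕ, (T : ℕ∞) ≤ τ → ((Finset.range T).filter p).card ≤ N) :
    {t : ℕ | (t : ℕ∞) < τ ∧ p t}.encard ≤ N := by
  by_contra! hlt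
  obtain ⟨s, hs, hcard⟩ := Set.exists_subset_encard_eq
    (show ((N + 1 : ℕ) : ℕ∞) ≤ _ by push_cast; exact Order.add_one_le_of_lt hlt)
  have hfin : s.Finite := Set.finite_of_encard_eq_coe hcard
  lift s to Finset ℕ using hfin
  rw [Set.encard_coe_eq_coe_finsetCard] at hcard
  have hcard' : s.card = N + 1 := by exact_mod_cast hcard
  have hne : s.Nonempty := Finset.card_pos.mp (by omega)
  have hm := hs (s.max'_mem hne)
  have := h (s.max' hne + 1) (by push_cast; exact Order.add_one_le_of_lt hm.1)
  have hsub : s ⊆ (Finset.range (s.max' hne + 1)).filter p := fun t ht =>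
    Finset.mem_filter.mpr ⟨Finset.mem_range.mpr (Nat.lt_succ_of_le (s.le_max' t ht)), (hs ht).2⟩
  have := Finset.card_le_card hsub
  omega

/-! ### A single round with payments -/

namespace ExtensiveGame

/-- Nash equilibrium of the game in which player `i` receives the payment `q i` on top of the
utility. -/
def IsNashWith (Γ : ExtensiveGame) (q : Fin Γ.n → Γ.Profile → ℝ) (x : Γ.Profile) : Prop :=
  ∀ (i : Fin Γ.n) (y : Γ.X i), Γ.expUtility i (Function.update x i y) +
    q i (Function.update x i y) ≤ Γ.expUtility i x + q i x

end ExtensiveGame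

section Round

variable {P : ℝ} {q : Fin coordGame.n → coordGame.Profile → ℝ}

theorem coordMix_eq_add_smul (i : Fin coordGame.n) (c : unitInterval) :
    (coordMix i c : coordGame.Seq i → ℝ) =
      (1 - (c : ℝ)) • (coordMix i 0 : coordGame.Seq i → ℝ) +
        (c : ℝ) • (coordMix i 1 : coordGame.Seq i → ℝ) := by
  have h (c : unitInterval) : (coordMix i c : coordGame.Seq i → ℝ) =
      (1 - (c : ℝ)) • coordGame.pureSeqForm i (coordPure i 0) +
        (c : ℝ) • coordGame.pureSeqForm i (coordPure i 1) := AffineMap.lineMap_apply_module _ _ _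
  rw [h, h 0, h 1]
  simp

theorem ExtensiveGame.IsPaymentFunction.update_coordMixProfile {i : Fin coordGame.n}
    {p : coordGame.Profile → ℝ} (hp : coordGame.IsPaymentFunction P i p)
    (w : Fin coordGame.n → unitInterval) (c : unitInterval) :
    p (coordMixProfile (Function.update w i c)) =
      (1 - (c : ℝ)) * p (coordMixProfile (Function.update w i 0)) +
        c * p (coordMixProfile (Function.update w i 1)) := by
  obtain ⟨ℓ, hℓ⟩ := hp.linear (coordMixProfile w)
  simp only [← _root_.update_coordMixProfile, hℓ]
  rw [coordMix_eq_add_smul, map_add, map_smul, map_smul, smul_eq_mul, smul_eq_mul]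

theorem expUtility_coord_mem_Icc (i : Fin coordGame.n) (x : coordGame.Profile) :
    coordGame.expUtility i x ∈ Set.Icc (0 : ℝ) 1 := by
  obtain ⟨w, rfl⟩ := coordMixProfile_surjective x
  rw [expUtility_coordMixProfile]
  exact ⟨coordUtility_nonneg w, coordUtility_le_one w⟩

theorem coordValue_update (hq : ∀ i, coordGame.IsPaymentFunction P i (q i)) (i : Fin coordGame.n)
    (w : Fin coordGame.n → unitInterval) (c : unitInterval) :
    coordUtility (Function.update w i c) + q i (coordMixProfile (Function.update w i c)) =
      (1 - (c : ℝ)) * (coordUtility (Function.update w i 0) +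
        q i (coordMixProfile (Function.update w i 0))) +
      c * (coordUtility (Function.update w i 1) +
        q i (coordMixProfile (Function.update w i 1))) := by
  have h : coordUtility (Function.update w i c) =
      (1 - (c : ℝ)) * coordUtility (Function.update w i 0) +
        c * coordUtility (Function.update w i 1) := coordUtility_update w i c
  rw [(hq i).update_coordMixProfile, h]
  ring

/-- Payments are linear in the own strategy and continuous in the other one, so a round with
payments still has an equilibrium. -/
theorem exists_isNashWith_coordGame (hq : ∀ i, coordGame.IsPaymentFunction P i (q i)) :
    ∃ x, coordGame.IsNashWith q x := by
  obtain ⟨(w : Fin coordGame.n → unitInterval), hw⟩ := exists_nash_unitSquare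
    (fun i w => coordUtility w + q i (coordMixProfile w)) (coordValue_update hq) (by
      intro (i : Fin coordGame.n) c
      refine Continuous.add ?_ ?_
      · exact continuous_coordUtility.comp (continuous_id.update i continuous_const)
      · have := ((hq i).continuous (coordMix i c)).comp continuous_coordMixProfile
        simp only [Function.comp_def, update_coordMixProfile] at this
        exact this)
  refine ⟨coordMixProfile w, fun i y => ?_⟩
  obtain ⟨c, rfl⟩ := coordMix_surjective i y
  rw [update_coordMixProfile, expUtility_coordMixProfile, expUtility_coordMixProfile]
  exact hw i c

/-- By affinity some player gains by switching to pure B. This drops the utility from 1/2 to 0, so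
the payment must make up for the loss. -/
theorem exists_half_le_payment (hq : ∀ i, coordGame.IsPaymentFunction P i (q i))
    (hA : ¬ coordGame.IsNashWith q coordAA) :
    ∃ x, x ≠ coordAA ∧ 1 / 2 ≤ ∑ i, q i x := by
  obtain ⟨i, hi⟩ : ∃ i, coordUtility (fun _ => 0) + q i coordAA <
      coordUtility (Function.update (fun _ => 0) i 1) +
        q i (coordMixProfile (Function.update (fun _ => 0) i 1)) := by
    by_contra! h
    refine hA fun i y => ?_
    obtain ⟨c, rfl⟩ := coordMix_surjective i y
    rw [← coordMixProfile_zero, update_coordMixProfile, expUtility_coordMixProfile,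
      expUtility_coordMixProfile]
    refine le_of_affine (g := fun c => coordUtility (Function.update (fun _ => 0) i c) +
      q i (coordMixProfile (Function.update (fun _ => 0) i c))) c
      (coordValue_update hq i _ c) (le_of_eq ?_) ?_
    · exact congrArg (fun w => coordUtility w + q i (coordMixProfile w))
        (Function.update_eq_self i fun _ => (0 : unitInterval))
    · rw [coordMixProfile_zero]; exact h i
  have hhalf : coordUtility (fun _ => 0) = 1 / 2 := by simp [coordUtility]
  have hzero (i : Fin 2) : coordUtility (Function.update (fun _ => 0) i 1) = 0 := by
    fin_cases i <;> simp [coordUtility]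
  have hz : coordUtility (Function.update (fun _ => 0) i 1) = 0 := hzero i
  have hAA := ((hq i).mem_Icc coordAA).1
  refine ⟨coordMixProfile (Function.update (fun _ => 0) i 1), fun h => ?_, ?_⟩
  · rw [h] at hi; linarith
  · refine le_trans ?_ (Finset.single_le_sum (f := fun j => q j _)
      (fun j _ => ((hq j).mem_Icc _).1) (Finset.mem_univ i))
    linarith

end Round

/-! ### Regret and payment per round -/

namespace ExtensiveGame.Mediator

variable {Γ : ExtensiveGame} {P : ℝ} (σ : Γ.Mediator P)

theorem regret_le_of_forall [∀ i, Nonempty (Γ.X i)] (hP : 0 ≤ P) {x : ℕ → Γ.Profile}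
    {i : Fin Γ.n} {T : ℕ} {r : ℝ}
    (h : ∀ y, ∑ t ∈ Finset.range T, (σ.roundUtility x t i y - σ.roundUtility x t i (x t i)) ≤
      (P + 1) * r) : σ.regret x i T ≤ r := by
  rw [regret, one_div_mul_eq_div, div_le_iff₀' (by linarith), sub_le_iff_le_add]
  refine ciSup_le fun y => ?_
  have := h y
  rw [Finset.sum_sub_distrib] at this
  linarith

theorem payment_nonneg (x : ℕ → Γ.Profile) (t : ℕ) (i : Fin Γ.n) (y : Γ.Profile) :
    0 ≤ σ.payment x t i y := ((σ.isPayment _ _ i).mem_Icc y).1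

theorem payment_le (x : ℕ → Γ.Profile) (t : ℕ) (i : Fin Γ.n) (y : Γ.Profile) :
    σ.payment x t i y ≤ P := ((σ.isPayment _ _ i).mem_Icc y).2

theorem roundUtility_sub_nonpos {x : ℕ → Γ.Profile} {t : ℕ}
    (h : Γ.IsNashWith (σ.payment x t) (x t)) (i : Fin Γ.n) (y : Γ.X i) :
    σ.roundUtility x t i y - σ.roundUtility x t i (x t i) ≤ 0 := by
  rw [sub_nonpos, roundUtility, roundUtility, Function.update_eq_self]
  exact h i y

end ExtensiveGame.Mediator

/-- Round values lie in [0, P + 1]; after normalization a bad round costs at most 1. -/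
theorem roundUtility_sub_le_coordGame {P : ℝ} (σ : coordGame.Mediator P)
    (x : ℕ → coordGame.Profile) (t : ℕ) (i : Fin coordGame.n) (y : coordGame.X i) :
    σ.roundUtility x t i y - σ.roundUtility x t i (x t i) ≤ P + 1 := by
  rw [ExtensiveGame.Mediator.roundUtility, ExtensiveGame.Mediator.roundUtility]
  have h1 := (expUtility_coord_mem_Icc i (Function.update (x t) i y)).2
  have h2 := (expUtility_coord_mem_Icc i (Function.update (x t) i (x t i))).1
  have h3 := σ.payment_le x t i (Function.update (x t) i y)
  have h4 := σ.payment_nonneg x t i (Function.update (x t) i (x t i))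
  linarith

/-! ### The players' strategy -/

/-- Against a mediator with total budget `B < K / 2`, the players can keep their regrets below
`√T` and play `(A, A)` in all but `K ^ 2 + K` rounds. -/
theorem exists_play_coordAA {P B : ℝ} {τ : ℕ∞} (σ : coordGame.Mediator P) {K : ℕ}
    (hK : 2 * B < K) (hσ : σ.RespectsBudget (fun T => Real.sqrt T) B τ) :
    ∃ x : ℕ → coordGame.Profile, σ.RegretBounded (fun T => Real.sqrt T) τ x ∧
      {t : ℕ | (t : ℕ∞) < τ ∧ x t ≠ coordAA}.encard ≤ (K ^ 2 + K : ℕ) := by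
  classical
  have hP : 0 ≤ P := by
    have h := (σ.isPayment 0 (fun s => s.elim0) (0 : Fin 2)).mem_Icc coordAA
    exact h.1.trans h.2
  have (i : Fin coordGame.n) : Nonempty (coordGame.X i) := ⟨coordMix i 0⟩
  -- The first alternative is the warm-up, or the state after K late departures; there any
  -- equilibrium of the round will do. The cap K lets the regret bound be proved before the budget
  -- is used.
  obtain ⟨x, hx⟩ := exists_seq_of_history (Q := fun t (g : Fin t → coordGame.Profile) y =>
    if t < K ^ 2 ∨ K ≤ ∑ s : Fin t, (if K ^ 2 ≤ (s : ℕ) ∧ g s ≠ coordAA then 1 else 0)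
    then coordGame.IsNashWith (σ.pay t g) y
    else (y = coordAA ∧ coordGame.IsNashWith (σ.pay t g) y) ∨
      (y ≠ coordAA ∧ 1 / 2 ≤ ∑ i, σ.pay t g i y)) (by
    intro t g
    split_ifs
    · exact exists_isNashWith_coordGame (σ.isPayment t g)
    · by_cases hA : coordGame.IsNashWith (σ.pay t g) coordAA
      · exact ⟨_, Or.inl ⟨rfl, hA⟩⟩
      · obtain ⟨y, hy⟩ := exists_half_le_payment (σ.isPayment t g) hA
        exact ⟨y, Or.inr hy⟩)
  -- `c` counts all departures from round `K ^ 2` on, including equilibrium ones after the cap.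
  -- Hence `min (c T) K` counts exactly the paid, possibly regretted, rounds.
  set c : ℕ → ℕ := fun T => ∑ s ∈ Finset.range T, (if K ^ 2 ≤ s ∧ x s ≠ coordAA then 1 else 0)
    with hc
  have hstep (t : ℕ) : c (t + 1) = c t + if K ^ 2 ≤ t ∧ x t ≠ coordAA then 1 else 0 :=
    Finset.sum_range_succ _ _
  have hearly (T : ℕ) (hT : T ≤ K ^ 2) : c T = 0 := by
    refine Finset.sum_eq_zero fun s hs => if_neg fun h => ?_
    have := Finset.mem_range.mp hs
    omega
  have hround (t : ℕ) : (min (c (t + 1)) K = min (c t) K ∧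
      coordGame.IsNashWith (σ.payment x t) (x t)) ∨
      (min (c (t + 1)) K = min (c t) K + 1 ∧ 1 / 2 ≤ ∑ i, σ.payment x t i (x t)) := by
    have h := hx t
    rw [Fin.sum_univ_eq_sum_range
      (fun s => if K ^ 2 ≤ s ∧ x s ≠ coordAA then 1 else 0) t] at h
    change if t < K ^ 2 ∨ K ≤ c t then coordGame.IsNashWith (σ.payment x t) (x t)
      else (x t = coordAA ∧ coordGame.IsNashWith (σ.payment x t) (x t)) ∨
      (x t ≠ coordAA ∧ 1 / 2 ≤ ∑ i, σ.payment x t i (x t)) at h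
    have hs := hstep t
    split_ifs at h with h1
    · refine Or.inl ⟨?_, h⟩
      rcases h1 with h1 | h1
      · rw [hearly t h1.le, hearly (t + 1) h1]
      · omega
    · push Not at h1
      rcases h with ⟨hA, h⟩ | ⟨hA, h⟩
      · rw [if_neg (by tauto)] at hs
        exact Or.inl ⟨by rw [hs, add_zero], h⟩
      · rw [if_pos ⟨h1.1, hA⟩] at hs
        exact Or.inr ⟨by omega, h⟩
  have hgain (i : Fin coordGame.n) (y : coordGame.X i) (T : ℕ) :
      ∑ t ∈ Finset.range T, (σ.roundUtility x t i y - σ.roundUtility x t i (x t i)) ≤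
        (P + 1) * (min (c T) K : ℕ) := by
    induction T with
    | zero => simp [hc]
    | succ T ih =>
      rw [Finset.sum_range_succ]
      rcases hround T with ⟨h, hN⟩ | ⟨h, -⟩
      · have := σ.roundUtility_sub_nonpos hN i y
        rw [h]; linarith
      · have := roundUtility_sub_le_coordGame σ x T i y
        rw [h]; push_cast at ih ⊢; linarith
  have hpay (T : ℕ) : ((min (c T) K : ℕ) : ℝ) / 2 ≤
      ∑ t ∈ Finset.range T, ∑ i, σ.payment x t i (x t) := by
    induction T with
    | zero => simp [hc]
    | succ T ih =>
      rw [Finset.sum_range_succ]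
      rcases hround T with ⟨h, -⟩ | ⟨h, hN⟩
      · have : 0 ≤ ∑ i, σ.payment x T i (x T) :=
          Finset.sum_nonneg fun i _ => σ.payment_nonneg x T i _
        rw [h]; linarith
      · rw [h]; push_cast at ih ⊢; linarith
  have hreg : σ.RegretBounded (fun T => Real.sqrt T) τ x := by
    refine fun T _ i => σ.regret_le_of_forall hP fun y => (hgain i y T).trans ?_
    -- Up to time K² there is no bad round; later there are at most K ≤ √T of them.
    refine mul_le_mul_of_nonneg_left (Real.le_sqrt_of_sq_le ?_) (by linarith)
    rcases le_total T (K ^ 2) with hT | hT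
    · simp [hearly T hT]
    · exact_mod_cast (Nat.pow_le_pow_left (min_le_right _ _) 2).trans hT
  refine ⟨x, hreg, Set.encard_setOf_lt_le fun T hT => ?_⟩
  -- Admissibility is now known, so the budget applies: reaching the cap would cost K/2 > B.
  have hcT : c T ≤ K := by
    by_contra! h
    have := (hpay T).trans (hσ x hreg T hT)
    rw [min_eq_right h.le] at this
    linarith
  refine le_trans ?_ (Nat.add_le_add_left hcT _)
  rw [hc]
  simp only [← Finset.card_filter]
  refine (Finset.card_le_card (t := Finset.range (K ^ 2) ∪
    (Finset.range T).filter fun s => K ^ 2 ≤ s ∧ x s ≠ coordAA) fun t ht => ?_).trans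
    ((Finset.card_union_le _ _).trans (by rw [Finset.card_range]))
  simp only [Finset.mem_filter, Finset.mem_range, Finset.mem_union] at ht ⊢
  rcases lt_or_ge t (K ^ 2) with h | h
  · exact Or.inl h
  · exact Or.inr ⟨ht.1, h, ht.2⟩

/-! ### Failure of steering -/

/-- The terminal node (A, A) alone gives the bound: the target never reaches it, while all but N
rounds reach it surely. -/
theorem le_directnessGap_coordBB [DecidableEq coordGame.Profile] {x : ℕ → coordGame.Profile}
    {T N : ℕ} (hT : 0 < T) (h : ((Finset.range T).filter fun t => x t ≠ coordAA).card ≤ N) :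
    1 - (N : ℝ) / T ≤ coordGame.directnessGap coordBB x T := by
  have hAA : coordGame.reach coordAA (coordTerminal 0 0) = 1 := by
    rw [← coordMixProfile_zero, reach_coordMixProfile]; simp
  have hBB : coordGame.reach coordBB (coordTerminal 0 0) = 0 := by
    rw [← coordMixProfile_one, reach_coordMixProfile]; simp
  have hnn (y : coordGame.Profile) : 0 ≤ coordGame.reach y (coordTerminal 0 0) := by
    obtain ⟨w, rfl⟩ := coordMixProfile_surjective y
    rw [reach_coordMixProfile, if_pos rfl, if_pos rfl]
    exact mul_nonneg (sub_nonneg.mpr (w _).2.2) (sub_nonneg.mpr (w _).2.2)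
  have hsum : (T : ℝ) - N ≤ ∑ t ∈ Finset.range T, coordGame.reach (x t) (coordTerminal 0 0) := by
    have h1 : ∑ t ∈ Finset.range T, (1 - if x t ≠ coordAA then (1 : ℝ) else 0) ≤
        ∑ t ∈ Finset.range T, coordGame.reach (x t) (coordTerminal 0 0) := by
      refine Finset.sum_le_sum fun t _ => ?_
      split_ifs with hx
      · simpa using hnn (x t)
      · rw [not_not.mp hx, hAA]; simp
    rw [Finset.sum_sub_distrib, Finset.sum_boole] at h1
    have h2 : (((Finset.range T).filter fun t => x t ≠ coordAA).card : ℝ) ≤ N := by exact_mod_cast h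
    simp only [Finset.sum_const, Finset.card_range, nsmul_eq_mul, mul_one] at h1
    linarith
  have hT' : (0 : ℝ) < T := by exact_mod_cast hT
  refine le_trans ?_ (Finset.single_le_sum (f := fun z => |(1 / (T : ℝ)) *
    ∑ t ∈ Finset.range T, coordGame.reach (x t) z - coordGame.reach coordBB z|)
    (fun _ _ => abs_nonneg _) (Finset.mem_univ (coordTerminal 0 0)))
  refine le_trans ?_ (le_abs_self _)
  rw [hBB, sub_zero, one_div_mul_eq_div, le_div_iff₀ hT', sub_mul, div_mul_cancel₀ _ hT'.ne',
    one_mul]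
  exact hsum

/-- One play per horizon is allowed, so that a constant family yields the infinitely repeated game.
-/
theorem not_tendsto_directnessGap_coordBB {x : ℕ → ℕ → coordGame.Profile} {N : ℕ}
    (h : ∀ T : ℕ, {t : ℕ | t < T ∧ x T t ≠ coordAA}.encard ≤ N) :
    ¬ Tendsto (fun T => coordGame.directnessGap coordBB (x T) T) atTop (𝓝 0) := by
  classical
  intro ht
  have h1 : Tendsto (fun T : ℕ => 1 - (N : ℝ) / T) atTop (𝓝 (1 - 0)) :=
    tendsto_const_nhds.sub (tendsto_const_div_atTop_nhds_zero_nat (N : ℝ))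
  have := le_of_tendsto_of_tendsto h1 ht (by
    filter_upwards [eventually_gt_atTop 0] with T hT
    refine le_directnessGap_coordBB hT ?_
    have hT' := h T
    rw [show {t : ℕ | t < T ∧ x T t ≠ coordAA} =
      ((Finset.range T).filter fun t => x T t ≠ coordAA : Finset ℕ) by ext; simp,
      Set.encard_coe_eq_coe_finsetCard] at hT'
    exact_mod_cast hT')
  norm_num at this

theorem mainTheorem7 :
    coordGame.IsNash coordAA ∧ coordGame.IsNash coordBB ∧
    ∃ R : ℕ → ℝ, R =O[atTop] (fun T : ℕ => Real.sqrt (T : ℝ)) ∧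
      ∀ B : ℝ, 0 ≤ B →
        ¬ coordGame.AnytimeSteerable coordBB R B ∧
        ¬ coordGame.HorizonSteerable coordBB R B ∧
        ∃ N : ℕ, ∀ (τ : ℕ∞) (P : ℝ) (σ : coordGame.Mediator P), σ.RespectsBudget R B τ →
          ∃ x : ℕ → coordGame.Profile, σ.RegretBounded R τ x ∧
            {t : ℕ | (t : ℕ∞) < τ ∧ x t ≠ coordAA}.encard ≤ N := by
  refine ⟨coordAA_isNash, coordBB_isNash, fun T => Real.sqrt T, isBigO_refl _ _, fun B _ => ?_⟩
  obtain ⟨K, hK⟩ := exists_nat_gt (2 * B)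
  refine ⟨?_, ?_, K ^ 2 + K, fun τ P σ hσ => exists_play_coordAA σ hK hσ⟩
  · rintro ⟨P, σ, hσ, hsteer⟩
    obtain ⟨x, hx, hN⟩ := exists_play_coordAA σ hK hσ
    refine not_tendsto_directnessGap_coordBB (x := fun _ => x)
      (fun T => (Set.encard_le_encard ?_).trans hN) (hsteer x hx).2
    exact fun t ht => ⟨ENat.natCast_lt_top t, ht.2⟩
  · rintro ⟨P, σ, hσ, hsteer⟩
    choose x hx hN using fun T => exists_play_coordAA (σ T) hK (hσ T)
    refine not_tendsto_directnessGap_coordBB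
      (fun T => (Set.encard_le_encard ?_).trans (hN T)) (hsteer x hx).2
    exact fun t ht => ⟨by exact_mod_cast ht.1, ht.2⟩
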